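/- For a functor $F:\mathcal A\to\mathcal B$ between small categories, let $MF$ be the category whose objects are pairs $(A,\ x:B\cong FA)$ with $A$ an object of $\mathcal A$ and $x$ an isomorphism of $\mathcal B$, and whose arrows $(A,x:B\cong FA)\to(A',x':B'\cong FA')$ are pairs $(b:B\to B',\ a:A\to A')$ with $x'\circ b=Fa\circ x$. Let $LF:\mathcal A\to MF$, $A\mapsto(A,\mathrm{id}_{FA})$, and $RF:MF\to\mathcal B$, $(A,x:B\cong FA)\mapsto B$. Then $F\mapsto RF$ is the object part of an endofunctor $R$ of the arrow category $\mathbf{Cat}^{\mathbf 2}$, which is pointed by the natural transformation $\mathrm{Id}\to R$ with components $\eta_F=(LF,\mathrm{id}_{\mathcal B}):F\to RF$. The same formulas define a pointed endofunctor $R$ of $\mathbf{Gpd}^{\mathbf 2}$, where $\mathbf{Gpd}$ is the category of small groupoids. Let $R\text{-}\mathbf{Map}$ be the category of algebras for the pointed endofunctor: its objects are arrows $F$ with a structure map $s:RF\to F$ in the arrow category such that $s\circ\eta_F=\mathrm{id}_F$ (equivalently, normal cloven isofibrations), and its morphisms are the commutative squares that commute with the structure maps (equivalently, preserve the cleavages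 strictly). Sending an algebra to the codomain of its underlying functor gives functors $R\text{-}\mathbf{Map}\to\mathbf{Cat}$ and $R\text{-}\mathbf{Map}\to\mathbf{Gpd}$. A fibration $p:\mathcal E\to\mathcal C$ has finite products if $\mathcal C$ and all the fibres $\mathcal E_X$ have finite products and reindexing preserves them. Such a fibration is elementary if, for all objects $Y,X$ of $\mathcal C$, reindexing along the parametrised diagonal $\delta_{Y,X}=\langle \mathrm{pr}_1,\mathrm{pr}_2,\mathrm{pr}_2\rangle:Y\times X\to Y\times X\times X$ has a left adjoint $\Sigma_{Y,X}$, and these adjoints satisfy - Frobenius reciprocity: for all $A$ over $Y\times X$ and $B$ over $Y\times X\times X$ the canonical arrow $\Sigma_{Y,X}(\delta_{Y,X}^*B\wedge A)\to B\wedge\Sigma_{Y,X}A$ is an isomorphism; - the Beck–Chevalley condition: for every $f:Y\to Z$ and every $A$ over $Z\times X$ the canonical arrow $\Sigma_{Y,X}(f\times X)^*A\to(f\times X\times X)^*\Sigma_{Z,X}A$ is an isomorphism. **Corollary (R-Map fibrations not elementary).** The functors $R\text{-}\mathbf{Map}\to\mathbf{Cat}$ and $R\text{-}\mathbf{Map}\to\mathbf{Gpd}$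 are fibrations with finite products, and neither of them is elementary. -/

import Mathlib

open CategoryTheory CategoryTheory.Limits

/-! ### Fibrations with finite products and elementary fibrations -/

namespace FibProd

universe v₁ u₁ v₂ u₂

variable {B : Type u₁} [Category.{v₁} B] {E : Type u₂} [Category.{v₂} E]

open CategoryTheory.Functor.Fiber (fiberInclusion)

section Reindexing

variable (p : E ⥤ B) [p.IsFibered]

/-- The reindexed object `f^* A` in the fibre over `X`, for `f : X ⟶ Y` and `A` over `Y`. -/
noncomputable def reindexObj {X Y : B} (f : X ⟶ Y) (A : p.Fiber Y) : p.Fiber X :=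
  ⟨Functor.IsPreFibered.pullbackObj A.2 f, Functor.IsPreFibered.pullbackObj_proj A.2 f⟩

/-- The chosen cartesian lift `f^* A ⟶ A` of `f`. -/
noncomputable def lift {X Y : B} (f : X ⟶ Y) (A : p.Fiber Y) :
    fiberInclusion.obj (reindexObj p f A) ⟶ fiberInclusion.obj A :=
  Functor.IsPreFibered.pullbackMap A.2 f

instance lift_isCartesian {X Y : B} (f : X ⟶ Y) (A : p.Fiber Y) :
    p.IsCartesian f (lift p f A) :=
  Functor.IsPreFibered.pullbackMap.IsCartesian A.2 f

/-- An arrow `C ⟶ A` over `f` as a vertical arrow `C ⟶ f^* A`. -/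
noncomputable def toReindex {X Y : B} (f : X ⟶ Y) {C : p.Fiber X} {A : p.Fiber Y}
    (φ : fiberInclusion.obj C ⟶ fiberInclusion.obj A) [p.IsHomLift f φ] :
    C ⟶ reindexObj p f A :=
  let ψ : fiberInclusion.obj C ⟶ fiberInclusion.obj (reindexObj p f A) :=
    Functor.IsCartesian.map p f (lift p f A) φ
  have hψ : p.IsHomLift (𝟙 X) ψ := Functor.IsCartesian.map_isHomLift p f (lift p f A) φ
  ⟨ψ, hψ⟩

theorem toReindex_fac {X Y : B} (f : X ⟶ Y) {C : p.Fiber X} {A : p.Fiber Y}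
    (φ : fiberInclusion.obj C ⟶ fiberInclusion.obj A) [p.IsHomLift f φ] :
    fiberInclusion.map (toReindex p f φ) ≫ lift p f A = φ :=
  Functor.IsCartesian.fac p f (lift p f A) φ

theorem hom_ext_lift {X Y : B} (f : X ⟶ Y) {C : p.Fiber X} {A : p.Fiber Y}
    {φ ψ : C ⟶ reindexObj p f A}
    (h : fiberInclusion.map φ ≫ lift p f A = fiberInclusion.map ψ ≫ lift p f A) : φ = ψ :=
  Functor.Fiber.hom_ext (Functor.IsCartesian.ext p f (lift p f A) _ _ h)

/-- The reindexing functor `f^* : E_Y ⥤ E_X` along `f : X ⟶ Y`. -/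
noncomputable def reindex {X Y : B} (f : X ⟶ Y) : p.Fiber Y ⥤ p.Fiber X where
  obj A := reindexObj p f A
  map {A A'} φ := toReindex p f (lift p f A ≫ fiberInclusion.map φ)
  map_id A := by
    apply hom_ext_lift
    rw [toReindex_fac]
    simp
  map_comp φ ψ := by
    apply hom_ext_lift
    rw [toReindex_fac, Functor.map_comp, Functor.map_comp, Category.assoc, toReindex_fac,
      ← Category.assoc, ← Category.assoc, toReindex_fac]

end Reindexing

/-- A fibration with finite products: the base and all the fibres have finite products,
and the reindexing functors preserve them. -/
class IsFibrationWithProducts (p : E ⥤ B) : Prop extends p.IsFibered where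
  base : HasFiniteProducts B
  fiber : ∀ X : B, HasFiniteProducts (p.Fiber X)
  reindex : ∀ {X Y : B} (f : X ⟶ Y), PreservesFiniteProducts (reindex p f)

attribute [instance] IsFibrationWithProducts.fiber

/-- The parametrised diagonal `⟨pr₁, pr₂, pr₂⟩ : Y × X ⟶ Y × X × X`. -/
noncomputable def parDiag [HasFiniteProducts B] (Y X : B) : Y ⨯ X ⟶ (Y ⨯ X) ⨯ X :=
  prod.lift (𝟙 (Y ⨯ X)) prod.snd

/-- `f × X × X` commutes with the parametrised diagonals. -/
theorem parDiag_naturality [HasFiniteProducts B] {Y Z : B} (f : Y ⟶ Z) (X : B) :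
    prod.map f (𝟙 X) ≫ parDiag Z X = parDiag Y X ≫ prod.map (prod.map f (𝟙 X)) (𝟙 X) := by
  unfold parDiag
  ext <;> simp

section Canonical

variable (p : E ⥤ B)

/-- For a left adjoint `L` of `d^*`, the canonical arrow `L (d^* C ∧ A) ⟶ C ∧ L A`. -/
noncomputable def frobeniusHom [IsFibrationWithProducts p] {V W : B} {d : V ⟶ W}
    {L : p.Fiber V ⥤ p.Fiber W} (adj : L ⊣ reindex p d) (A : p.Fiber V) (C : p.Fiber W) :
    L.obj ((reindex p d).obj C ⨯ A) ⟶ C ⨯ L.obj A :=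
  prod.lift (L.map prod.fst ≫ adj.counit.app C) (L.map prod.snd)

variable [p.IsFibered]

/-- The arrow `a^* A ⟶ L' A` over `a ≫ d'` obtained by composing the cartesian lift of `a`,
the unit of `L' ⊣ d'^*` and the cartesian lift of `d'`. -/
noncomputable def beckChevalleyOver {V V' W' : B} (a : V ⟶ V') {d' : V' ⟶ W'}
    {L' : p.Fiber V' ⥤ p.Fiber W'} (adj' : L' ⊣ reindex p d') (A : p.Fiber V') :
    fiberInclusion.obj (reindexObj p a A) ⟶ fiberInclusion.obj (L'.obj A) :=
  lift p a A ≫ fiberInclusion.map (X := A) (Y := reindexObj p d' (L'.obj A)) (adj'.unit.app A) ≫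
    lift p d' (L'.obj A)

theorem beckChevalleyOver_isHomLift {V V' W W' : B} {a : V ⟶ V'} {d : V ⟶ W} {d' : V' ⟶ W'}
    {b : W ⟶ W'} (h : a ≫ d' = d ≫ b)
    {L' : p.Fiber V' ⥤ p.Fiber W'} (adj' : L' ⊣ reindex p d') (A : p.Fiber V') :
    p.IsHomLift (d ≫ b) (beckChevalleyOver p a adj' A) := by
  rw [← h]
  let η : A ⟶ reindexObj p d' (L'.obj A) := adj'.unit.app A
  have h₁ : p.IsHomLift d' (fiberInclusion.map η ≫ lift p d' (L'.obj A)) := inferInstance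
  exact IsHomLift.comp (p := p) a d' (lift p a A) (fiberInclusion.map η ≫ lift p d' (L'.obj A))

/-- For a commutative square `a ≫ d' = d ≫ b` in the base and left adjoints `L ⊣ d^*` and
`L' ⊣ d'^*`, the canonical arrow `L (a^* A) ⟶ b^* (L' A)`: the transpose of the composite
`a^* A ⟶ a^* (d'^* (L' A)) ≅ d^* (b^* (L' A))` of the reindexed unit with the
canonical isomorphism. -/
noncomputable def beckChevalleyHom {V V' W W' : B} {a : V ⟶ V'} {d : V ⟶ W} {d' : V' ⟶ W'}
    {b : W ⟶ W'} (h : a ≫ d' = d ≫ b)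
    {L : p.Fiber V ⥤ p.Fiber W} (adj : L ⊣ reindex p d)
    {L' : p.Fiber V' ⥤ p.Fiber W'} (adj' : L' ⊣ reindex p d') (A : p.Fiber V') :
    L.obj ((reindex p a).obj A) ⟶ (reindex p b).obj (L'.obj A) :=
  have _ := beckChevalleyOver_isHomLift p h adj' A
  (adj.homEquiv _ _).symm (toReindex p d (C := reindexObj p a A) (A := reindexObj p b (L'.obj A))
    (Functor.IsStronglyCartesian.map p b (lift p b (L'.obj A)) (g := d) rfl
      (beckChevalleyOver p a adj' A)))

end Canonical

/-- A fibration with products is elementary if reindexing along each parametrised diagonal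
has a left adjoint, and these left adjoints satisfy Frobenius reciprocity and the Beck-Chevalley
condition. -/
structure IsElementary (p : E ⥤ B) : Prop extends IsFibrationWithProducts p where
  exists_leftAdjoint :
    have := base
    ∃ (L : ∀ Y X : B, p.Fiber (Y ⨯ X) ⥤ p.Fiber ((Y ⨯ X) ⨯ X))
      (adj : ∀ Y X : B, L Y X ⊣ FibProd.reindex p (parDiag Y X)),
      (∀ (Y X : B) (A : p.Fiber (Y ⨯ X)) (C : p.Fiber ((Y ⨯ X) ⨯ X)),
        IsIso (frobeniusHom p (adj Y X) A C)) ∧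
      (∀ (Y Z X : B) (f : Y ⟶ Z) (A : p.Fiber (Z ⨯ X)),
        IsIso (beckChevalleyHom p (parDiag_naturality f X) (adj Y X) (adj Z X) A))

end FibProd

/-! ### Algebras for a pointed endofunctor -/

/-- The category of algebras for a pointed endofunctor `η : 𝟭 ⟶ R`: the algebras
`s : R A ⟶ A` with `η ≫ s = 𝟙`, with all the arrows that commute with the structure maps. -/
abbrev PointedAlgebra {C : Type*} [Category* C] {R : C ⥤ C} (η : 𝟭 C ⟶ R) :=
  ObjectProperty.FullSubcategory
    (fun A : Endofunctor.Algebra R => η.app A.a ≫ A.str = 𝟙 A.a)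

/-- The functor that sends an algebra for a pointed endofunctor on the category of arrows
of `C` to the codomain of its underlying arrow. -/
def pointedAlgebraCod {C : Type*} [Category* C] {R : Arrow C ⥤ Arrow C} (η : 𝟭 (Arrow C) ⟶ R) :
    PointedAlgebra η ⥤ C :=
  ObjectProperty.ι _ ⋙ Endofunctor.Algebra.forget R ⋙ Arrow.rightFunc

/-! ### The factorisation through the category of isomorphisms `b ≅ F a` -/

namespace IsoFact

universe v u

section

variable {A : Type u} [Category.{v} A] {B : Type u} [Category.{v} B]

/-- The objects of the category `M F`: an object `a` of `A`, an object `b` of `B`, and an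
isomorphism `b ≅ F a` in `B`. -/
structure M (F : A ⥤ B) : Type (max u v) where
  a : A
  b : B
  iso : b ≅ F.obj a

/-- The arrows of the category `M F`: pairs of an arrow of `B` and an arrow of `A` that make
the evident square commute. -/
@[ext]
structure M.Hom {F : A ⥤ B} (m m' : M F) where
  b : m.b ⟶ m'.b
  a : m.a ⟶ m'.a
  w : b ≫ m'.iso.hom = m.iso.hom ≫ F.map a

@[simps! id_a id_b comp_a comp_b]
instance (F : A ⥤ B) : Category.{v} (M F) where
  Hom m m' := M.Hom m m'
  id m := ⟨𝟙 _, 𝟙 _, by simp⟩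
  comp f g := ⟨f.b ≫ g.b, f.a ≫ g.a, by
    rw [Category.assoc, g.w, ← Category.assoc, f.w, Category.assoc, F.map_comp]⟩

@[ext]
theorem M.hom_ext {F : A ⥤ B} {m m' : M F} {f g : m ⟶ m'} (hb : f.b = g.b) (ha : f.a = g.a) :
    f = g :=
  M.Hom.ext hb ha

/-- The functor `L F : A ⥤ M F`, `a ↦ (a, id : F a ≅ F a)`. -/
@[simps]
def L (F : A ⥤ B) : A ⥤ M F where
  obj a := ⟨a, F.obj a, Iso.refl _⟩
  map f := ⟨F.map f, f, by simp⟩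

/-- The functor `R F : M F ⥤ B`, `(a, x : b ≅ F a) ↦ b`. -/
@[simps]
def R (F : A ⥤ B) : M F ⥤ B where
  obj m := m.b
  map f := f.b

theorem L_comp_R (F : A ⥤ B) : L F ⋙ R F = F := rfl

variable {A' : Type u} [Category.{v} A'] {B' : Type u} [Category.{v} B']

theorem square_obj {F : A ⥤ B} {G : A' ⥤ B'} {H : A ⥤ A'} {K : B ⥤ B'} (w : H ⋙ G = F ⋙ K)
    (a : A) : K.obj (F.obj a) = G.obj (H.obj a) :=
  (Functor.congr_obj w a).symm

theorem square_map {F : A ⥤ B} {G : A' ⥤ B'} {H : A ⥤ A'} {K : B ⥤ B'} (w : H ⋙ G = F ⋙ K)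
    {a a' : A} (f : a ⟶ a') : K.map (F.map f) ≫ eqToHom (square_obj w a') =
      eqToHom (square_obj w a) ≫ G.map (H.map f) := by
  have h : G.map (H.map f) = eqToHom (square_obj w a).symm ≫ K.map (F.map f) ≫
      eqToHom (square_obj w a') := Functor.congr_hom w f
  rw [h]
  simp

/-- The functor `M F ⥤ M G` induced by a commutative square of functors
`(H, K) : F ⟶ G`, sending `(a, x : b ≅ F a)` to `(H a, K x : K b ≅ K (F a) = G (H a))`. -/
@[simps]
def mapM {F : A ⥤ B} {G : A' ⥤ B'} (H : A ⥤ A') (K : B ⥤ B') (w : H ⋙ G = F ⋙ K) :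
    M F ⥤ M G where
  obj m := ⟨H.obj m.a, K.obj m.b,
    K.mapIso m.iso ≪≫ eqToIso (square_obj w m.a)⟩
  map {m m'} f := ⟨K.map f.b, H.map f.a, by
    have h := congrArg K.map f.w
    rw [Functor.map_comp, Functor.map_comp] at h
    simp only [Iso.trans_hom, Functor.mapIso_hom, eqToIso.hom, Category.assoc]
    rw [← square_map w, ← Category.assoc, h, Category.assoc]⟩

theorem M.ext_heq {F : A ⥤ B} {m m' : M F} (ha : m.a = m'.a) (hb : m.b = m'.b)
    (h : HEq m.iso.hom m'.iso.hom) : m = m' := by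
  obtain ⟨a, b, x⟩ := m
  obtain ⟨a', b', x'⟩ := m'
  dsimp at ha hb h
  subst ha hb
  rw [Iso.ext (eq_of_heq h)]

theorem M.hom_heq {F : A ⥤ B} {m₁ m₁' m₂ m₂' : M F} (h₁ : m₁ = m₂) (h₂ : m₁' = m₂')
    (f : m₁ ⟶ m₁') (g : m₂ ⟶ m₂') (hb : HEq f.b g.b) (ha : HEq f.a g.a) : HEq f g := by
  subst h₁ h₂
  exact heq_of_eq (M.hom_ext (eq_of_heq hb) (eq_of_heq ha))

theorem functor_hext {C : Type*} [Category* C] {F : A ⥤ B} {P Q : C ⥤ M F}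
    (ha : ∀ c, (P.obj c).a = (Q.obj c).a) (hb : ∀ c, (P.obj c).b = (Q.obj c).b)
    (hx : ∀ c, HEq (P.obj c).iso.hom (Q.obj c).iso.hom)
    (hma : ∀ {c d : C} (f : c ⟶ d), HEq (P.map f).a (Q.map f).a)
    (hmb : ∀ {c d : C} (f : c ⟶ d), HEq (P.map f).b (Q.map f).b) : P = Q :=
  have h : ∀ c, P.obj c = Q.obj c := fun c => M.ext_heq (ha c) (hb c) (hx c)
  Functor.hext h (fun c d f => M.hom_heq (h c) (h d) _ _ (hmb f) (hma f))

theorem mapM_id (F : A ⥤ B) (w : 𝟭 A ⋙ F = F ⋙ 𝟭 B) : mapM (𝟭 A) (𝟭 B) w = 𝟭 (M F) :=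
  functor_hext (fun _ => rfl) (fun _ => rfl) (fun m => heq_of_eq (by
      change m.iso.hom ≫ eqToHom (square_obj w m.a) = m.iso.hom
      simp))
    (fun _ => HEq.rfl) (fun _ => HEq.rfl)

theorem mapM_comp {A'' : Type u} [Category.{v} A''] {B'' : Type u} [Category.{v} B'']
    {F : A ⥤ B} {F' : A' ⥤ B'} {F'' : A'' ⥤ B''} (H : A ⥤ A') (K : B ⥤ B')
    (w : H ⋙ F' = F ⋙ K) (H' : A' ⥤ A'') (K' : B' ⥤ B'') (w' : H' ⋙ F'' = F' ⋙ K')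
    (w'' : (H ⋙ H') ⋙ F'' = F ⋙ (K ⋙ K')) :
    mapM (H ⋙ H') (K ⋙ K') w'' = mapM H K w ⋙ mapM H' K' w' :=
  functor_hext (fun _ => rfl) (fun _ => rfl) (fun m => heq_of_eq (by
      change K'.map (K.map m.iso.hom) ≫ eqToHom (square_obj w'' m.a) =
        K'.map (K.map m.iso.hom ≫ eqToHom (square_obj w m.a)) ≫ eqToHom (square_obj w' (H.obj m.a))
      simp [eqToHom_map]))
    (fun _ => HEq.rfl) (fun _ => HEq.rfl)

theorem L_naturality {F : A ⥤ B} {G : A' ⥤ B'} (H : A ⥤ A') (K : B ⥤ B')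
    (w : H ⋙ G = F ⋙ K) : H ⋙ L G = L F ⋙ mapM H K w := by
  have key : ∀ {c d : B'} (e : c = d), HEq (𝟙 c) (eqToHom e.symm) := by
    rintro c _ rfl; rfl
  refine functor_hext (fun _ => rfl) (fun a => Functor.congr_obj w a) (fun a => ?_)
    (fun _ => HEq.rfl) (fun f => Functor.hcongr_hom w f)
  have h : ((L F ⋙ mapM H K w).obj a).iso.hom = eqToHom (square_obj w a) := by
    change K.map (𝟙 (F.obj a)) ≫ eqToHom (square_obj w a) = _
    simp
  rw [h]
  exact key (Functor.congr_obj w a)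

end

section

variable {A : Type u} [Groupoid.{v} A] {B : Type u} [Groupoid.{v} B]

/-- `M F` is a groupoid when `F` is a functor between groupoids. -/
instance groupoidM (F : A ⥤ B) : Groupoid.{v} (M F) where
  inv {m m'} f := ⟨Groupoid.inv f.b, Groupoid.inv f.a, by
    rw [Groupoid.inv_eq_inv, Groupoid.inv_eq_inv, IsIso.inv_comp_eq, ← Category.assoc, f.w]
    simp⟩
  inv_comp f := by ext <;> simp
  comp_inv f := by ext <;> simp

end

end IsoFact

/-! ### The pointed endofunctor on arrows of `Cat` and of `Grpd`, and its algebras -/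

universe u

namespace CatR

/-- The endofunctor `F ↦ R F` on the arrow category of `Cat`. -/
def R : Arrow Cat.{u, u} ⥤ Arrow Cat.{u, u} where
  obj F := Arrow.mk (IsoFact.R F.hom.toFunctor).toCatHom
  map {F G} φ := Arrow.homMk
    (IsoFact.mapM φ.left.toFunctor φ.right.toFunctor
      (congrArg Cat.Hom.toFunctor φ.w)).toCatHom φ.right rfl
  map_id F := by
    apply Arrow.hom_ext
    · exact congrArg Functor.toCatHom (IsoFact.mapM_id F.hom.toFunctor rfl)
    · rfl
  map_comp φ ψ := by
    apply Arrow.hom_ext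
    · exact congrArg Functor.toCatHom (IsoFact.mapM_comp _ _ (congrArg Cat.Hom.toFunctor φ.w)
        _ _ (congrArg Cat.Hom.toFunctor ψ.w) (congrArg Cat.Hom.toFunctor (φ ≫ ψ).w))
    · rfl

/-- The unit `(L F, id) : F ⟶ R F`. -/
def unit : 𝟭 (Arrow Cat.{u, u}) ⟶ R where
  app F := Arrow.homMk (IsoFact.L F.hom.toFunctor).toCatHom (𝟙 F.right) rfl
  naturality F G φ := by
    apply Arrow.hom_ext
    · exact congrArg Functor.toCatHom (IsoFact.L_naturality _ _ (congrArg Cat.Hom.toFunctor φ.w))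
    · rfl

end CatR

namespace GrpdR

/-- The endofunctor `F ↦ R F` on the arrow category of `Grpd`. -/
def R : Arrow Grpd.{u, u} ⥤ Arrow Grpd.{u, u} where
  obj F := Arrow.mk (X := Grpd.of (IsoFact.M F.hom)) (Y := F.right) (IsoFact.R F.hom)
  map {F G} φ := Arrow.homMk (IsoFact.mapM φ.left φ.right φ.w) φ.right rfl
  map_id F := by
    apply Arrow.hom_ext
    · exact IsoFact.mapM_id F.hom rfl
    · rfl
  map_comp φ ψ := by
    apply Arrow.hom_ext
    · exact IsoFact.mapM_comp _ _ φ.w _ _ ψ.w (φ ≫ ψ).w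
    · rfl

/-- The unit `(L F, id) : F ⟶ R F`. -/
def unit : 𝟭 (Arrow Grpd.{u, u}) ⟶ R where
  app F := 
    let l : F.left ⟶ (R.obj F).left := IsoFact.L F.hom
    let r : F.right ⟶ (R.obj F).right := 𝟙 F.right
    (Arrow.homMk l r rfl : F ⟶ R.obj F)
  naturality F G φ := by
    apply Arrow.hom_ext
    · exact IsoFact.L_naturality _ _ φ.w
    · rfl

end GrpdR

/-!
The codomain component of the unit is invertible, so the codomain component of a structure map is
forced. Hence a jointly cartesian lift, in the arrow category, of a family of algebras carries
exactly one structure map for which its projections are algebra morphisms, and cartesian arrows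
and fibred products of algebras come from those in the arrow category.

An algebra transports a point over the target of a path to a point over its source. This transport
is natural in the algebra and trivial along constant paths. By Frobenius reciprocity for the
diagonal of `X`, a point of `A` over the first coordinate of `X × X` and a point of the equality
predicate give a point of `A` over the second coordinate. Along a path in `X × X` whose second
coordinate is constant, naturality then recovers a point of `A` over the target from its transport,
so transport is injective in an elementary fibration. It is not injective for the isofibration from
three points to two, all isomorphic, whose cleavage chooses the same lift for both points of the
larger fibre.
-/

namespace FibProd

universe w v₁ u₁ v₂ u₂

variable {B : Type u₁} [Category.{v₁} B] {E : Type u₂} [Category.{v₂} E]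

open CategoryTheory.Functor.Fiber (fiberInclusion)

section CartLift

variable (p : E ⥤ B) [p.IsFibered] {X Y : B} (f : X ⟶ Y)

/-- The chosen cartesian lift, with its domain written as a value of the functor `reindex p f`. -/
noncomputable def cartLift (A : p.Fiber Y) :
    fiberInclusion.obj ((reindex p f).obj A) ⟶ fiberInclusion.obj A :=
  lift p f A

instance cartLift_isCartesian (A : p.Fiber Y) : p.IsCartesian f (cartLift p f A) :=
  lift_isCartesian p f A

theorem reindex_map_cartLift {A A' : p.Fiber Y} (φ : A ⟶ A') :
    fiberInclusion.map ((reindex p f).map φ) ≫ cartLift p f A' =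
      cartLift p f A ≫ fiberInclusion.map φ :=
  toReindex_fac p f (C := reindexObj p f A) (lift p f A ≫ fiberInclusion.map φ)

variable {A : p.Fiber Y}

theorem exists_map_comp_cartLift {Z : p.Fiber X} (φ : fiberInclusion.obj Z ⟶ fiberInclusion.obj A)
    [p.IsHomLift f φ] :
    ∃ χ : Z ⟶ (reindex p f).obj A, fiberInclusion.map χ ≫ cartLift p f A = φ :=
  ⟨toReindex p f φ, toReindex_fac p f φ⟩

theorem exists_comp_cartLift {Z : E} {X' : B} (g : X' ⟶ X) (φ : Z ⟶ fiberInclusion.obj A)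
    [p.IsHomLift (g ≫ f) φ] :
    ∃ χ : Z ⟶ fiberInclusion.obj ((reindex p f).obj A),
      p.IsHomLift g χ ∧ χ ≫ cartLift p f A = φ :=
  ⟨Functor.IsStronglyCartesian.map p f (cartLift p f A) (g := g) rfl φ, inferInstance,
    Functor.IsStronglyCartesian.fac p f (cartLift p f A) rfl φ⟩

end CartLift

section JointlyCartesian

variable (p : E ⥤ B) {ι : Type w}

/-- A family of arrows `φ i : P ⟶ A i` over `g i : X ⟶ Y i` is jointly cartesian if the families
`ψ i : Z ⟶ A i` over `f ≫ g i` factor uniquely through it over `f`. For the empty family `P` is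
terminal over `X`, for a single arrow this is a cartesian arrow, and for identities `g i` it is a
product in the fibre over `X` that is stable under reindexing. -/
structure IsJointlyCartesian {X : B} {P : E} {Y : ι → B} {A : ι → E} (g : ∀ i, X ⟶ Y i)
    (φ : ∀ i, P ⟶ A i) : Prop where
  domain_eq : p.obj P = X
  isHomLift : ∀ i, p.IsHomLift (g i) (φ i)
  existsUnique : ∀ {Z : E} (f : p.obj Z ⟶ X) (ψ : ∀ i, Z ⟶ A i),
    (∀ i, p.IsHomLift (f ≫ g i) (ψ i)) → ∃! χ : Z ⟶ P, p.IsHomLift f χ ∧ ∀ i, χ ≫ φ i = ψ i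

/-- Every family of arrows `X ⟶ p.obj (A i)` indexed by `ι` has a jointly cartesian lift. -/
def HasJointlyCartesianLifts (ι : Type w) : Prop :=
  ∀ (X : B) (A : ι → E) (g : ∀ i, X ⟶ p.obj (A i)),
    ∃ (P : E) (φ : ∀ i, P ⟶ A i), IsJointlyCartesian p g φ

variable {p}

theorem IsJointlyCartesian.isStronglyCartesian [Nonempty ι] {X Y : B} {P A : E} {g : X ⟶ Y}
    {φ : P ⟶ A} (h : IsJointlyCartesian p (fun _ : ι => g) fun _ => φ) :
    p.IsStronglyCartesian g φ where
  toIsHomLift := h.isHomLift (Classical.arbitrary ι)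
  universal_property' f ψ _ := by
    simpa only [forall_const] using h.existsUnique f (fun _ => ψ) fun _ => inferInstance

theorem HasJointlyCartesianLifts.isFibered [Unique ι] (h : HasJointlyCartesianLifts p ι) :
    p.IsFibered :=
  .of_exists_isStronglyCartesian fun A X f => by
    obtain ⟨P, φ, hφ⟩ := h X (fun _ => A) fun _ => f
    have φ_const : φ = fun _ => φ default := funext fun i => by rw [Unique.eq_default i]
    rw [φ_const] at hφ
    exact ⟨P, φ default, hφ.isStronglyCartesian⟩

theorem IsJointlyCartesian.existsUnique_of_eq {X : B} {P : E} {Y : ι → B} {A : ι → E}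
    {g : ∀ i, X ⟶ Y i} {φ : ∀ i, P ⟶ A i} (h : IsJointlyCartesian p g φ) {X' : B} {Z : E}
    (hZ : p.obj Z = X') (f : X' ⟶ X) (ψ : ∀ i, Z ⟶ A i) (hψ : ∀ i, p.IsHomLift (f ≫ g i) (ψ i)) :
    ∃! χ : Z ⟶ P, p.IsHomLift f χ ∧ ∀ i, χ ≫ φ i = ψ i := by
  subst hZ
  exact h.existsUnique f ψ hψ

theorem HasJointlyCartesianLifts.exists_of_eq (h : HasJointlyCartesianLifts p ι) {X : B}
    {Y : ι → B} {A : ι → E} (hA : ∀ i, p.obj (A i) = Y i) (g : ∀ i, X ⟶ Y i) :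
    ∃ (P : E) (φ : ∀ i, P ⟶ A i), IsJointlyCartesian p g φ := by
  obtain rfl := funext hA
  exact h X A g

theorem IsJointlyCartesian.hom_ext {X : B} {P : E} {Y : ι → B} {A : ι → E}
    {g : ∀ i, X ⟶ Y i} {φ : ∀ i, P ⟶ A i} (h : IsJointlyCartesian p g φ) {Z : E} {χ χ' : Z ⟶ P}
    (h_map : p.map χ = p.map χ') (h_comp : ∀ i, χ ≫ φ i = χ' ≫ φ i) : χ = χ' := by
  obtain rfl := h.domain_eq
  refine (h.existsUnique (p.map χ) (fun i => χ ≫ φ i) fun i => ?_).unique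
    ⟨inferInstance, fun _ => rfl⟩ ⟨h_map ▸ inferInstance, fun i => (h_comp i).symm⟩
  have := h.isHomLift i
  infer_instance

section Fibre

variable {X : B} {A : ι → p.Fiber X} {P : p.Fiber X} {φ : ∀ i, P ⟶ A i}

theorem IsJointlyCartesian.nonempty_isLimit
    (h : IsJointlyCartesian p (fun _ => 𝟙 X) fun i => fiberInclusion.map (φ i)) :
    Nonempty (IsLimit (Fan.mk P φ)) := by
  have existsUnique_lift (s : Fan A) : ∃! χ : s.pt ⟶ P, ∀ i, χ ≫ φ i = s.proj i := by
    obtain ⟨χ, ⟨hχ, fac⟩, uniq⟩ := h.existsUnique_of_eq s.pt.2 (𝟙 X)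
      (fun i => fiberInclusion.map (s.proj i)) fun i => by
        rw [Category.comp_id]
        exact (s.proj i).2
    exact ⟨⟨χ, hχ⟩, fun i => Functor.Fiber.hom_ext (fac i), fun χ' fac' =>
      Functor.Fiber.hom_ext (uniq χ'.1 ⟨χ'.2, fun i => congrArg Subtype.val (fac' i)⟩)⟩
  choose l fac uniq using existsUnique_lift
  exact ⟨Fan.IsLimit.mk _ l fac fun s m hm => uniq s m hm⟩

theorem IsJointlyCartesian.reindex [p.IsFibered]
    (h : IsJointlyCartesian p (fun _ => 𝟙 X) fun i => fiberInclusion.map (φ i))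
    {X' : B} (f : X' ⟶ X) :
    IsJointlyCartesian p (fun _ => 𝟙 X')
      fun i => fiberInclusion.map ((FibProd.reindex p f).map (φ i)) where
  domain_eq := ((FibProd.reindex p f).obj P).2
  isHomLift _ := inferInstance
  existsUnique {Z} k ψ hψ := by
    replace hψ (i) : p.IsHomLift k (ψ i) := by simpa only [Category.comp_id] using hψ i
    obtain ⟨χ, ⟨hχ, fac⟩, uniq⟩ := h.existsUnique (k ≫ f) (fun i => ψ i ≫ cartLift p f (A i))
      fun i => by
        rw [Category.comp_id]
        infer_instance
    obtain ⟨χ', hχ', χ'_lift⟩ := exists_comp_cartLift p f (A := P) k χ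
    refine ⟨χ', ⟨hχ', fun i => ?_⟩, fun m ⟨hm, fac'⟩ => ?_⟩
    · refine Functor.IsStronglyCartesian.ext p f (cartLift p f (A i)) k ?_
      rw [Category.assoc, reindex_map_cartLift, reassoc_of% χ'_lift, fac]
    · refine Functor.IsStronglyCartesian.ext p f (cartLift p f P) k ?_
      rw [χ'_lift]
      refine uniq _ ⟨inferInstance, fun i => ?_⟩
      rw [Category.assoc, ← reindex_map_cartLift, ← fac' i, Category.assoc]

end Fibre

theorem isFibrationWithProducts_of_hasJointlyCartesianLifts [HasFiniteProducts B]
    (h : ∀ n, HasJointlyCartesianLifts p (Fin n)) : IsFibrationWithProducts p := by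
  have isFibered : p.IsFibered := (h 1).isFibered
  have exists_fan {n : ℕ} {X : B} (A : Fin n → p.Fiber X) : ∃ (P : p.Fiber X) (φ : ∀ i, P ⟶ A i),
      IsJointlyCartesian p (fun _ => 𝟙 X) fun i => fiberInclusion.map (φ i) := by
    obtain ⟨P, φ, hφ⟩ := (h n).exists_of_eq (fun i => (A i).2) fun _ => 𝟙 X
    exact ⟨⟨P, hφ.domain_eq⟩, fun i => ⟨φ i, hφ.isHomLift i⟩, hφ⟩
  refine { base := ‹_›, fiber := fun X => ⟨fun n => ⟨fun D => ?_⟩⟩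
           reindex := fun f => ⟨fun n => ⟨fun {D} => ?_⟩⟩ }
  · obtain ⟨P, φ, hφ⟩ := exists_fan (D.obj ∘ Discrete.mk)
    obtain ⟨hP⟩ := hφ.nonempty_isLimit
    have : HasLimit (Discrete.functor (D.obj ∘ Discrete.mk)) := ⟨⟨_, hP⟩⟩
    exact hasLimit_of_iso (Discrete.natIsoFunctor (F := D)).symm
  · obtain ⟨P, φ, hφ⟩ := exists_fan (D.obj ∘ Discrete.mk)
    obtain ⟨hP⟩ := hφ.nonempty_isLimit
    obtain ⟨hP'⟩ := (hφ.reindex f).nonempty_isLimit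
    have : PreservesLimit (Discrete.functor (D.obj ∘ Discrete.mk)) (reindex p f) :=
      preservesLimit_of_preserves_limit_cone hP ((Fan.isLimitMapConeEquiv ..).symm hP')
    exact preservesLimit_of_iso_diagram _ (Discrete.natIsoFunctor (F := D)).symm

end JointlyCartesian

end FibProd

namespace FibProd

theorem isHomLift_comp_iff {B D E : Type*} [Category* B] [Category* D] [Category* E] (q : D ⥤ E)
    (p : E ⥤ B) {X Y : B} (f : X ⟶ Y) {A A' : D} (φ : A ⟶ A') :
    (q ⋙ p).IsHomLift f φ ↔ p.IsHomLift f (q.map φ) := by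
  constructor
  · intro
    subst_hom_lift (q ⋙ p) f φ
    exact .map (q.map φ)
  · intro
    exact IsHomLift.of_fac' _ f φ (IsHomLift.domain_eq p f (q.map φ))
      (IsHomLift.codomain_eq p f (q.map φ)) (IsHomLift.fac' p f (q.map φ))

theorem isHomLift_iff_map_eq {B E : Type*} [Category* B] [Category* E] {p : E ⥤ B} {A A' : E}
    {f : p.obj A ⟶ p.obj A'} {φ : A ⟶ A'} : p.IsHomLift f φ ↔ p.map φ = f :=
  ⟨fun _ => (IsHomLift.eq_of_isHomLift p f φ).symm, fun h => h ▸ .map φ⟩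

section ArrowCod

variable {C : Type*} [Category* C]

theorem hasJointlyCartesianLifts_rightFunc (ι : Type*) [HasProductsOfShape ι C] [HasPullbacks C] :
    HasJointlyCartesianLifts (Arrow.rightFunc : Arrow C ⥤ C) ι := by
  intro X A (g : ∀ i, X ⟶ (A i).right)
  let hom := Limits.Pi.map fun i => (A i).hom
  let fst := pullback.fst hom (Limits.Pi.lift g)
  let snd := pullback.snd hom (Limits.Pi.lift g)
  have condition i : (fst ≫ Limits.Pi.π _ i) ≫ (A i).hom = snd ≫ g i := by
    simpa [hom] using pullback.condition (f := hom) (g := Limits.Pi.lift g) =≫ Limits.Pi.π _ i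
  let φ i : Arrow.mk snd ⟶ A i := Arrow.homMk (fst ≫ Limits.Pi.π _ i) (g i) (condition i)
  refine ⟨Arrow.mk snd, φ, rfl, fun i => .map (φ i), fun {Z} (f : Z.right ⟶ X) ψ hψ => ?_⟩
  replace hψ i : (ψ i).right = f ≫ g i := isHomLift_iff_map_eq.1 (hψ i)
  obtain ⟨l, l_fst, l_snd⟩ := pullback.lift' (f := hom) (g := Limits.Pi.lift g)
    (Limits.Pi.lift fun i => (ψ i).left) (Z.hom ≫ f) <| by
      ext i
      simp [hom, hψ]
  refine ⟨Arrow.homMk l f l_snd, ⟨isHomLift_iff_map_eq.2 rfl, fun i => ?_⟩,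
    fun χ ⟨hχ, fac⟩ => ?_⟩
  · apply Arrow.hom_ext
    · simpa [φ] using l_fst =≫ Limits.Pi.π _ i
    · exact (hψ i).symm
  · replace hχ : χ.right = f := isHomLift_iff_map_eq.1 hχ
    apply Arrow.hom_ext
    · apply pullback.hom_ext
      · ext i
        simpa [l_fst, φ] using congrArg Arrow.Hom.left (fac i)
      · exact (χ.w.trans (hχ ▸ rfl)).trans l_snd.symm
    · exact hχ

end ArrowCod

end FibProd

namespace PointedAlgebra

open FibProd

universe w v₁ u₁ v₂ u₂

variable {B : Type u₁} [Category.{v₁} B] {E : Type u₂} [Category.{v₂} E]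

section

variable {R : E ⥤ E} (η : 𝟭 E ⟶ R)

/-- The functor sending an algebra to its underlying object. -/
abbrev forget : PointedAlgebra η ⥤ E :=
  ObjectProperty.ι _ ⋙ Endofunctor.Algebra.forget R

variable {η} {p : E ⥤ B}

theorem isHomLift_forget_iff {X Y : B} {f : X ⟶ Y} {A A' : PointedAlgebra η} {φ : A ⟶ A'} :
    (forget η ⋙ p).IsHomLift f φ ↔ p.IsHomLift f φ.hom.f :=
  isHomLift_comp_iff ..

variable [∀ F, IsIso (p.map (η.app F))]

theorem map_str (A : PointedAlgebra η) : p.map A.obj.str = inv (p.map (η.app A.obj.a)) :=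
  IsIso.eq_inv_of_hom_inv_id (by
    rw [← p.map_comp, A.property]
    exact p.map_id _)

theorem map_map_comp_str {F : E} (A : PointedAlgebra η) (φ : F ⟶ A.obj.a) :
    p.map (R.map φ ≫ A.obj.str) = inv (p.map (η.app F)) ≫ p.map φ := by
  rw [p.map_comp, map_str, IsIso.comp_inv_eq, Category.assoc, IsIso.eq_inv_comp, ← p.map_comp,
    ← p.map_comp]
  exact congrArg p.map (η.naturality φ).symm

variable {ι : Type w} {X : B} {Y : ι → B} {g : ∀ i, X ⟶ Y i}

theorem exists_str {A : ι → PointedAlgebra η} {F : E} {φ : ∀ i, F ⟶ (A i).obj.a}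
    (hφ : IsJointlyCartesian p g φ) :
    ∃ s : R.obj F ⟶ F, η.app F ≫ s = 𝟙 F ∧ ∀ i, R.map (φ i) ≫ (A i).obj.str = s ≫ φ i := by
  obtain rfl := hφ.domain_eq
  have isHomLift i : p.IsHomLift (inv (p.map (η.app F)) ≫ g i) (R.map (φ i) ≫ (A i).obj.str) := by
    have := hφ.isHomLift i
    refine IsHomLift.of_fac' _ _ _ rfl (IsHomLift.codomain_eq p (g i) (φ i)) ?_
    rw [map_map_comp_str, IsHomLift.fac' p (g i) (φ i)]
    simp
  obtain ⟨s, ⟨hs, fac⟩, -⟩ := hφ.existsUnique _ _ isHomLift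
  refine ⟨s, hφ.hom_ext ?_ fun i => ?_, fun i => (fac i).symm⟩
  · have map_s : p.map s = inv (p.map (η.app F)) := (IsHomLift.eq_of_isHomLift p _ s).symm
    rw [p.map_comp, map_s, IsIso.hom_inv_id]
    exact (p.map_id F).symm
  · have η_naturality : η.app F ≫ R.map (φ i) = φ i ≫ η.app _ := (η.naturality (φ i)).symm
    rw [Category.assoc, fac, reassoc_of% η_naturality, (A i).property, Category.comp_id]
    exact (Category.id_comp (φ i)).symm

theorem isJointlyCartesian_of_forget {P : PointedAlgebra η} {A : ι → PointedAlgebra η}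
    {φ : ∀ i, P ⟶ A i} (h : IsJointlyCartesian p g fun i => (φ i).hom.f) :
    IsJointlyCartesian (forget η ⋙ p) g φ where
  domain_eq := h.domain_eq
  isHomLift i := isHomLift_forget_iff.2 (h.isHomLift i)
  existsUnique {Z} (k : p.obj Z.obj.a ⟶ X) ψ hψ := by
    obtain ⟨χ, ⟨hχ, fac⟩, uniq⟩ := h.existsUnique (Z := Z.obj.a) k (fun i => (ψ i).hom.f) fun i =>
      isHomLift_forget_iff.1 (hψ i)
    have map_comp_str : R.map χ ≫ P.obj.str = Z.obj.str ≫ χ := by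
      refine h.hom_ext ?_ fun i => ?_
      · rw [map_map_comp_str, p.map_comp, map_str]
      · rw [Category.assoc, ← (φ i).hom.h, ← R.map_comp_assoc, fac, (ψ i).hom.h, Category.assoc,
          fac]
    refine ⟨⟨⟨χ, map_comp_str⟩⟩, ⟨isHomLift_forget_iff.2 hχ, fun i => ?_⟩,
      fun m hm => ?_⟩
    · exact ObjectProperty.hom_ext _ (Endofunctor.Algebra.ext (fac i))
    · exact ObjectProperty.hom_ext _ (Endofunctor.Algebra.ext (uniq _
        ⟨isHomLift_forget_iff.1 hm.1, fun i => congrArg (fun m => m.hom.f) (hm.2 i)⟩))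

theorem hasJointlyCartesianLifts (h : HasJointlyCartesianLifts p ι) :
    HasJointlyCartesianLifts (forget η ⋙ p) ι := by
  intro X A g
  obtain ⟨F, φ, hφ⟩ := h X (fun i => (A i).obj.a) g
  obtain ⟨s, unit_comp, hs⟩ := exists_str hφ
  exact ⟨⟨⟨F, s⟩, unit_comp⟩, fun i => ⟨⟨φ i, hs i⟩⟩, isJointlyCartesian_of_forget hφ⟩

end

theorem isFibrationWithProducts {C : Type*} [Category* C] [HasFiniteProducts C] [HasPullbacks C]
    {R : Arrow C ⥤ Arrow C} (η : 𝟭 (Arrow C) ⟶ R) [∀ F, IsIso (η.app F).right] :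
    IsFibrationWithProducts (pointedAlgebraCod η) := by
  have (F : Arrow C) : IsIso (Arrow.rightFunc.map (η.app F)) :=
    inferInstanceAs (IsIso (η.app F).right)
  exact isFibrationWithProducts_of_hasJointlyCartesianLifts (p := forget η ⋙ Arrow.rightFunc)
    fun n => hasJointlyCartesianLifts (hasJointlyCartesianLifts_rightFunc (Fin n))

end PointedAlgebra

namespace FibProd

universe v₁ u₁ v₂ u₂

variable {B : Type u₁} [Category.{v₁} B] {E : Type u₂} [Category.{v₂} E] {p : E ⥤ B}

open CategoryTheory.Functor.Fiber (fiberInclusion)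

section Products

variable [IsFibrationWithProducts p] {X Y : B} {Z : p.Fiber X} {A A' : p.Fiber Y}

theorem exists_prod_lift {f : X ⟶ Y} (φ : fiberInclusion.obj Z ⟶ fiberInclusion.obj A)
    (φ' : fiberInclusion.obj Z ⟶ fiberInclusion.obj A') [p.IsHomLift f φ] [p.IsHomLift f φ'] :
    ∃ χ : fiberInclusion.obj Z ⟶ fiberInclusion.obj (A ⨯ A'), p.IsHomLift f χ ∧
      χ ≫ fiberInclusion.map prod.fst = φ ∧ χ ≫ fiberInclusion.map prod.snd = φ' := by
  have := IsFibrationWithProducts.reindex (p := p) f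
  obtain ⟨l, l_comp⟩ := exists_map_comp_cartLift p f φ
  obtain ⟨l', l'_comp⟩ := exists_map_comp_cartLift p f φ'
  obtain ⟨χ, (χ_fst : χ ≫ (reindex p f).map prod.fst = l),
    (χ_snd : χ ≫ (reindex p f).map prod.snd = l')⟩ := BinaryFan.IsLimit.lift'
      (isLimitOfHasBinaryProductOfPreservesLimit (reindex p f) A A') l l'
  refine ⟨fiberInclusion.map (Y := (reindex p f).obj (A ⨯ A')) χ ≫ cartLift p f (A ⨯ A'),
    inferInstance, ?_, ?_⟩
  · rw [Category.assoc, ← reindex_map_cartLift, ← Functor.map_comp_assoc, χ_fst, l_comp]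
  · rw [Category.assoc, ← reindex_map_cartLift, ← Functor.map_comp_assoc, χ_snd, l'_comp]

theorem prod_hom_ext (f : X ⟶ Y) {χ χ' : fiberInclusion.obj Z ⟶ fiberInclusion.obj (A ⨯ A')}
    [p.IsHomLift f χ] [p.IsHomLift f χ']
    (h_fst : χ ≫ fiberInclusion.map prod.fst = χ' ≫ fiberInclusion.map prod.fst)
    (h_snd : χ ≫ fiberInclusion.map prod.snd = χ' ≫ fiberInclusion.map prod.snd) : χ = χ' := by
  have := IsFibrationWithProducts.reindex (p := p) f
  obtain ⟨l, rfl⟩ := exists_map_comp_cartLift p f χ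
  obtain ⟨l', rfl⟩ := exists_map_comp_cartLift p f χ'
  have comp_map {D : p.Fiber Y} (π : A ⨯ A' ⟶ D)
      (h : (fiberInclusion.map l ≫ cartLift p f _) ≫ fiberInclusion.map π =
        (fiberInclusion.map l' ≫ cartLift p f _) ≫ fiberInclusion.map π) :
      l ≫ (reindex p f).map π = l' ≫ (reindex p f).map π :=
    Functor.Fiber.hom_ext <| Functor.IsCartesian.ext p f (cartLift p f D) _ _ <| by
      simpa only [Functor.map_comp, Category.assoc, reindex_map_cartLift] using h
  rw [BinaryFan.IsLimit.hom_ext (isLimitOfHasBinaryProductOfPreservesLimit (reindex p f) A A')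
    (comp_map prod.fst h_fst) (comp_map prod.snd h_snd)]

end Products

section Frobenius

variable [IsFibrationWithProducts p] {V W : B} {d : V ⟶ W} {L : p.Fiber V ⥤ p.Fiber W}
  (adj : L ⊣ reindex p d) (K : p.Fiber V) (C : p.Fiber W)

/-- The transpose of the canonical arrow `L (d^* C ∧ K) ⟶ C ∧ L K` of Frobenius reciprocity. -/
noncomputable def frobeniusMate :
    (reindex p d).obj C ⨯ K ⟶ (reindex p d).obj (C ⨯ L.obj K) :=
  adj.homEquiv _ _ (frobeniusHom p adj K C)

theorem frobeniusMate_fst :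
    frobeniusMate adj K C ≫ (reindex p d).map prod.fst = prod.fst := by
  rw [frobeniusMate, ← adj.homEquiv_naturality_right, frobeniusHom, prod.lift_fst,
    ← adj.homEquiv_counit, Equiv.apply_symm_apply]

theorem frobeniusMate_snd :
    frobeniusMate adj K C ≫ (reindex p d).map prod.snd =
      prod.snd ≫ adj.homEquiv K (L.obj K) (𝟙 _) := by
  rw [frobeniusMate, ← adj.homEquiv_naturality_right, frobeniusHom, prod.lift_snd,
    ← adj.homEquiv_naturality_left, Category.comp_id]

/-- The arrow `d^* C ∧ K ⟶ C ∧ L K` over `d` corresponding to `frobeniusMate`. -/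
noncomputable def frobeniusOver :
    fiberInclusion.obj ((reindex p d).obj C ⨯ K) ⟶ fiberInclusion.obj (C ⨯ L.obj K) :=
  fiberInclusion.map (frobeniusMate adj K C) ≫ cartLift p d (C ⨯ L.obj K)

instance : p.IsHomLift d (frobeniusOver adj K C) := by
  unfold frobeniusOver
  infer_instance

theorem frobeniusOver_fst : frobeniusOver adj K C ≫ fiberInclusion.map prod.fst =
    fiberInclusion.map prod.fst ≫ cartLift p d C := by
  rw [frobeniusOver, Category.assoc, ← reindex_map_cartLift, ← Functor.map_comp_assoc,
    frobeniusMate_fst]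

theorem frobeniusOver_snd : frobeniusOver adj K C ≫ fiberInclusion.map prod.snd =
    fiberInclusion.map prod.snd ≫
      fiberInclusion.map (adj.homEquiv K (L.obj K) (𝟙 _)) ≫ cartLift p d (L.obj K) := by
  rw [frobeniusOver, Category.assoc, ← reindex_map_cartLift, ← Functor.map_comp_assoc,
    frobeniusMate_snd, Functor.map_comp_assoc]

theorem exists_frobeniusOver_comp_eq [IsIso (frobeniusHom p adj K C)] {X : B} (π : W ⟶ X)
    {D : p.Fiber X} (ψ : fiberInclusion.obj ((reindex p d).obj C ⨯ K) ⟶ fiberInclusion.obj D)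
    [p.IsHomLift (d ≫ π) ψ] :
    ∃ τ : fiberInclusion.obj (C ⨯ L.obj K) ⟶ fiberInclusion.obj D,
      p.IsHomLift π τ ∧ frobeniusOver adj K C ≫ τ = ψ := by
  obtain ⟨ψ', hψ', rfl⟩ := exists_comp_cartLift p π d ψ
  obtain ⟨φ, rfl⟩ := exists_map_comp_cartLift p d ψ'
  let τ := inv (frobeniusHom p adj K C) ≫ (adj.homEquiv _ _).symm φ
  have mate_comp : frobeniusMate adj K C ≫ (reindex p d).map τ = φ := by
    rw [frobeniusMate, ← adj.homEquiv_naturality_right, IsIso.hom_inv_id_assoc,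
      Equiv.apply_symm_apply]
  refine ⟨fiberInclusion.map τ ≫ cartLift p π D, inferInstance, ?_⟩
  rw [frobeniusOver, Category.assoc, ← reassoc_of% (reindex_map_cartLift p d τ),
    ← Functor.map_comp_assoc, mate_comp, Category.assoc]

end Frobenius

/-- Transport of points along paths in the objects of the total category. A point of `A` is an
arrow `pt ⟶ A`, a path in `X` is an arrow `path ⟶ X`; a point over the target of a path is
transported to a point over its source, naturally in `A`, and transport along the constant paths
is trivial. -/
structure PathTransport (p : E ⥤ B) where
  {base : B}
  pt : p.Fiber base
  path : B
  source : base ⟶ path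
  target : base ⟶ path
  const : path ⟶ base
  target_const : target ≫ const = 𝟙 base
  transport {X : B} (x : path ⟶ X) {A : p.Fiber X}
    (a : fiberInclusion.obj pt ⟶ fiberInclusion.obj A) (ha : p.IsHomLift (target ≫ x) a) :
    fiberInclusion.obj pt ⟶ fiberInclusion.obj A
  isHomLift {X : B} (x : path ⟶ X) {A : p.Fiber X}
    (a : fiberInclusion.obj pt ⟶ fiberInclusion.obj A) (ha) :
    p.IsHomLift (source ≫ x) (transport x a ha)
  transport_comp {X Y : B} {x : path ⟶ X} {f : X ⟶ Y} {y : path ⟶ Y} {A : p.Fiber X}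
    {A' : p.Fiber Y} {a : fiberInclusion.obj pt ⟶ fiberInclusion.obj A}
    {φ : fiberInclusion.obj A ⟶ fiberInclusion.obj A'}
    {a' : fiberInclusion.obj pt ⟶ fiberInclusion.obj A'} (ha ha') (_ : p.IsHomLift f φ)
    (hxf : x ≫ f = y) (haφ : a ≫ φ = a') : transport x a ha ≫ φ = transport y a' ha'
  transport_const {X : B} (x : base ⟶ X) {A : p.Fiber X}
    (a : fiberInclusion.obj pt ⟶ fiberInclusion.obj A) (ha) : transport (const ≫ x) a ha = a

namespace PathTransport

variable (S : PathTransport p)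

section Frobenius

variable [IsFibrationWithProducts p] {V W X : B} {d : V ⟶ W} {π₁ π₂ : W ⟶ X}
  {L : p.Fiber V ⥤ p.Fiber W} (adj : L ⊣ reindex p d) {K : p.Fiber V} {A : p.Fiber X}
  {x : S.path ⟶ X} {q : S.base ⟶ V} {y : S.path ⟶ W}

theorem exists_comp_frobeniusOver (hq : q ≫ d = S.target ≫ y) (h₁ : y ≫ π₁ = x)
    (k : fiberInclusion.obj S.pt ⟶ fiberInclusion.obj K) [p.IsHomLift q k]
    (a : fiberInclusion.obj S.pt ⟶ fiberInclusion.obj A) [p.IsHomLift (S.target ≫ x) a] :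
    ∃ w : fiberInclusion.obj S.pt ⟶
        fiberInclusion.obj ((reindex p d).obj ((reindex p π₁).obj A) ⨯ K),
      p.IsHomLift (S.target ≫ y) (w ≫ frobeniusOver adj K _) ∧
      w ≫ fiberInclusion.map prod.fst ≫ cartLift p d _ ≫ cartLift p π₁ A = a ∧
      w ≫ fiberInclusion.map prod.snd = k := by
  have : p.IsHomLift ((q ≫ d) ≫ π₁) a := by rwa [hq, Category.assoc, h₁]
  obtain ⟨a', _, rfl⟩ := exists_comp_cartLift p π₁ (q ≫ d) a
  obtain ⟨a'', _, rfl⟩ := exists_comp_cartLift p d q a'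
  obtain ⟨w, hw, w_fst, w_snd⟩ := exists_prod_lift (f := q) a'' k
  exact ⟨w, hq ▸ inferInstance, by rw [reassoc_of% w_fst, Category.assoc], w_snd⟩

theorem transport_injective_of_frobenius (hd : d ≫ π₁ = d ≫ π₂)
    [IsIso (frobeniusHom p adj K ((reindex p π₁).obj A))] (hq : q ≫ d = S.target ≫ y)
    (h₁ : y ≫ π₁ = x) (h₂ : y ≫ π₂ = S.const ≫ S.target ≫ x)
    (k : fiberInclusion.obj S.pt ⟶ fiberInclusion.obj K) [p.IsHomLift q k]
    {a b : fiberInclusion.obj S.pt ⟶ fiberInclusion.obj A} (ha hb)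
    (h : S.transport x a ha = S.transport x b hb) : a = b := by
  let ψ : fiberInclusion.obj ((reindex p d).obj ((reindex p π₁).obj A) ⨯ K) ⟶ _ :=
    fiberInclusion.map prod.fst ≫ cartLift p d _ ≫ cartLift p π₁ A
  have hψ : p.IsHomLift (d ≫ π₂) ψ := hd ▸ inferInstance
  obtain ⟨τ, hτ, comp_τ⟩ := exists_frobeniusOver_comp_eq adj K _ π₂ ψ
  obtain ⟨u, hu, u_ψ, u_snd⟩ := S.exists_comp_frobeniusOver adj hq h₁ k a
  obtain ⟨v, hv, v_ψ, v_snd⟩ := S.exists_comp_frobeniusOver adj hq h₁ k b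
  have transport_eq : S.transport y _ hu = S.transport y _ hv := by
    have := S.isHomLift y _ hu
    have := S.isHomLift y _ hv
    refine prod_hom_ext (S.source ≫ y)
      (Functor.IsStronglyCartesian.ext p π₁ (cartLift p π₁ A) (S.source ≫ y) ?_) ?_
    · rw [Category.assoc, Category.assoc, S.transport_comp hu ha inferInstance h₁,
        S.transport_comp hv hb inferInstance h₁, h]
      · rw [← v_ψ, Category.assoc, reassoc_of% (frobeniusOver_fst adj K)]
      · rw [← u_ψ, Category.assoc, reassoc_of% (frobeniusOver_fst adj K)]
    · have hk : p.IsHomLift (S.target ≫ y)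
          (k ≫ fiberInclusion.map (adj.homEquiv K (L.obj K) (𝟙 _)) ≫ cartLift p d _) :=
        hq ▸ inferInstance
      rw [S.transport_comp hu hk inferInstance (Category.comp_id y),
        S.transport_comp hv hk inferInstance (Category.comp_id y)]
      · rw [Category.assoc, frobeniusOver_snd, reassoc_of% v_snd]
      · rw [Category.assoc, frobeniusOver_snd, reassoc_of% u_snd]
  have transport_comp_τ {c : fiberInclusion.obj S.pt ⟶ fiberInclusion.obj A}
      (hc : p.IsHomLift (S.target ≫ x) c) {w} (hw) (w_ψ : w ≫ ψ = c) :
      S.transport y (w ≫ frobeniusOver adj K _) hw ≫ τ = c := by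
    rw [S.transport_comp hw _ hτ h₂ (by rw [Category.assoc, comp_τ, w_ψ])]
    · exact S.transport_const ..
    · rwa [reassoc_of% S.target_const]
  rw [← transport_comp_τ ha hu u_ψ, ← transport_comp_τ hb hv v_ψ, transport_eq]

end Frobenius

theorem transport_injective_of_isElementary (hp : IsElementary p) {X : B} {A : p.Fiber X}
    {x : S.path ⟶ X} {a b : fiberInclusion.obj S.pt ⟶ fiberInclusion.obj A} (ha hb)
    (h : S.transport x a ha = S.transport x b hb) : a = b := by
  have := hp.toIsFibrationWithProducts
  have : HasFiniteProducts B := hp.base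
  obtain ⟨L, adj, isIso_frobeniusHom, -⟩ := hp.exists_leftAdjoint
  let q : S.base ⟶ S.base ⨯ X := prod.lift (𝟙 _) (S.target ≫ x)
  let y : S.path ⟶ (S.base ⨯ X) ⨯ X := prod.lift (prod.lift S.const x) (S.const ≫ S.target ≫ x)
  have : p.IsHomLift (q ≫ prod.snd) a := by rwa [prod.lift_snd]
  obtain ⟨k, hk, -⟩ := exists_comp_cartLift p prod.snd q a
  have := isIso_frobeniusHom S.base X ((reindex p prod.snd).obj A)
    ((reindex p (prod.fst ≫ prod.snd)).obj A)
  refine S.transport_injective_of_frobenius (adj S.base X) (π₁ := prod.fst ≫ prod.snd)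
    (π₂ := prod.snd) (q := q) (y := y) ?_ ?_ ?_ ?_ k ha hb h
  · rw [parDiag, prod.lift_fst_assoc, Category.id_comp, prod.lift_snd]
  · have q_snd : q ≫ prod.snd = S.target ≫ x := prod.lift_snd ..
    rw [parDiag, prod.comp_lift, prod.comp_lift, prod.comp_lift, Category.comp_id, q_snd,
      S.target_const, reassoc_of% S.target_const]
  · rw [prod.lift_fst_assoc, prod.lift_snd]
  · exact prod.lift_snd ..

end PathTransport

end FibProd

theorem FibProd.isStronglyCocartesian_rightFunc {C : Type*} [Category* C] {F G : Arrow C}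
    (φ : F ⟶ G) (_ : IsIso φ.left) :
    Arrow.rightFunc.IsStronglyCocartesian (Arrow.rightFunc.map φ) φ where
  toIsHomLift := .map φ
  universal_property' {H} (g : G.right ⟶ H.right) ψ hψ := by
    replace hψ : ψ.right = φ.right ≫ g := isHomLift_iff_map_eq.1 hψ
    refine ⟨Arrow.homMk (inv φ.left ≫ ψ.left) g ?_, ⟨isHomLift_iff_map_eq.2 rfl, ?_⟩,
      fun χ ⟨hχ, fac⟩ => ?_⟩
    · rw [Category.assoc, IsIso.inv_comp_eq, ψ.w, hψ, φ.w_assoc]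
    · apply Arrow.hom_ext
      · exact IsIso.hom_inv_id_assoc ..
      · exact hψ.symm
    · apply Arrow.hom_ext
      · exact (IsIso.eq_inv_comp _).2 (congrArg Arrow.Hom.left fac)
      · exact isHomLift_iff_map_eq.1 hχ

namespace PointedAlgebra

open FibProd

universe v₁ u₁ v₂ u₂

variable {B : Type u₁} [Category.{v₁} B] {E : Type u₂} [Category.{v₂} E] {R : E ⥤ E}

theorem unit_map_comp_str {η : 𝟭 E ⟶ R} (A : PointedAlgebra η) {F : E} (a : F ⟶ A.obj.a) :
    η.app F ≫ R.map a ≫ A.obj.str = a := by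
  have η_naturality : η.app F ≫ R.map a = a ≫ η.app _ := (η.naturality a).symm
  rw [reassoc_of% η_naturality, A.property, Category.comp_id]

/-- A path object for lifting paths in algebras. An arrow `J ⟶ F` is thought of as a path in the
base together with a point of `F` over its target, and `start` produces from it a point of `R F`
over the source of the path, which an algebra structure turns into a point of `F`. -/
structure PathLifting (η : 𝟭 E ⟶ R) (p : E ⥤ B) where
  pt : E
  J : E
  isIso_unit : IsIso (η.app pt)
  target : pt ⟶ J
  const : J ⟶ pt
  start : pt ⟶ R.obj J
  target_const : target ≫ const = 𝟙 pt
  start_const : start ≫ R.map const = η.app pt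
  isStronglyCocartesian : p.IsStronglyCocartesian (p.map target) target

namespace PathLifting

variable {η : 𝟭 E ⟶ R} {p : E ⥤ B} (S : PathLifting η p)

attribute [instance] isIso_unit isStronglyCocartesian

/-- The object `pt` as an algebra, with the only possible structure map. -/
noncomputable def ptAlgebra : PointedAlgebra η :=
  ⟨⟨S.pt, inv (η.app S.pt)⟩, IsIso.hom_inv_id _⟩

/-- A point of an algebra, as an algebra morphism. -/
noncomputable def ofPoint {A : PointedAlgebra η} (a : S.pt ⟶ A.obj.a) : S.ptAlgebra ⟶ A :=
  ⟨⟨a, ((IsIso.inv_comp_eq (η.app S.pt)).2 (A.unit_map_comp_str a).symm).symm⟩⟩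

/-- The source of the lift of a path that is given by the structure map of `A`. -/
def lift (A : PointedAlgebra η) (e : S.J ⟶ A.obj.a) : S.pt ⟶ A.obj.a :=
  S.start ≫ R.map e ≫ A.obj.str

theorem lift_comp {A A' : PointedAlgebra η} (e : S.J ⟶ A.obj.a) (φ : A ⟶ A') :
    S.lift A e ≫ φ.hom.f = S.lift A' (e ≫ φ.hom.f) := by
  simp only [lift, Category.assoc, R.map_comp, φ.hom.h]

theorem lift_const {A : PointedAlgebra η} (a : S.pt ⟶ A.obj.a) : S.lift A (S.const ≫ a) = a := by
  rw [lift, R.map_comp_assoc, reassoc_of% S.start_const, A.unit_map_comp_str]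

/-- The path `x` in the base, together with the point `a` over its target, as an arrow from `J`. -/
noncomputable def extend {X : B} (x : p.obj S.J ⟶ X) {F : E} (a : S.pt ⟶ F)
    (_ : p.IsHomLift (p.map S.target ≫ x) a) : S.J ⟶ F :=
  Functor.IsStronglyCocartesian.map p (p.map S.target) S.target (g := x) rfl a

section

variable {X : B} (x : p.obj S.J ⟶ X) {F : E} (a : S.pt ⟶ F)
  (ha : p.IsHomLift (p.map S.target ≫ x) a)

theorem isHomLift_extend : p.IsHomLift x (S.extend x a ha) :=
  Functor.IsStronglyCocartesian.map_isHomLift ..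

theorem target_comp_extend : S.target ≫ S.extend x a ha = a :=
  Functor.IsStronglyCocartesian.fac ..

variable {x a}

theorem extend_eq {e : S.J ⟶ F} (_ : p.IsHomLift x e) (h : S.target ≫ e = a) :
    S.extend x a ha = e :=
  (Functor.IsStronglyCocartesian.map_uniq p (p.map S.target) S.target rfl a e h).symm

theorem extend_comp {Y : B} {f : X ⟶ Y} {G : E} {φ : F ⟶ G}
    (ha' : p.IsHomLift (p.map S.target ≫ x ≫ f) (a ≫ φ)) (_ : p.IsHomLift f φ) :
    S.extend (x ≫ f) (a ≫ φ) ha' = S.extend x a ha ≫ φ :=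
  have := S.isHomLift_extend x a ha
  S.extend_eq ha' inferInstance (by rw [reassoc_of% S.target_comp_extend x a ha])

end

theorem extend_const {X : B} {x : p.obj S.pt ⟶ X} {F : E} {a : S.pt ⟶ F}
    (ha : p.IsHomLift (p.map S.target ≫ p.map S.const ≫ x) a) :
    S.extend (p.map S.const ≫ x) a ha = S.const ≫ a := by
  have : p.IsHomLift x a := by
    rwa [← p.map_comp_assoc, S.target_const, p.map_id, Category.id_comp] at ha
  exact S.extend_eq ha inferInstance (by rw [reassoc_of% S.target_const])

variable [∀ F, IsIso (p.map (η.app F))]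

/-- The source of the path underlying `J`. -/
noncomputable def source : p.obj S.pt ⟶ p.obj S.J :=
  p.map S.start ≫ inv (p.map (η.app S.J))

theorem map_lift {A : PointedAlgebra η} (e : S.J ⟶ A.obj.a) :
    p.map (S.lift A e) = S.source ≫ p.map e := by
  rw [lift, p.map_comp, map_map_comp_str, source, Category.assoc]

theorem isHomLift_lift {X : B} {x : p.obj S.J ⟶ X} {A : PointedAlgebra η} {e : S.J ⟶ A.obj.a}
    (_ : p.IsHomLift x e) : p.IsHomLift (S.source ≫ x) (S.lift A e) := by
  obtain rfl := IsHomLift.codomain_eq p x e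
  obtain rfl := IsHomLift.eq_of_isHomLift p x e
  exact isHomLift_iff_map_eq.2 (S.map_lift e)

/-- The transport of points along paths that is given by the structure maps of the algebras. -/
noncomputable def pathTransport : PathTransport (forget η ⋙ p) where
  base := p.obj S.pt
  pt := ⟨S.ptAlgebra, rfl⟩
  path := p.obj S.J
  source := S.source
  target := p.map S.target
  const := p.map S.const
  target_const := by rw [← p.map_comp, S.target_const, p.map_id]
  transport x A a ha := S.ofPoint (S.lift A.1 (S.extend x a.hom.f (isHomLift_forget_iff.1 ha)))
  isHomLift x A a ha :=
    isHomLift_forget_iff.2 (S.isHomLift_lift (S.isHomLift_extend ..))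
  transport_comp {X Y x f y A A' a φ a'} ha ha' hφ hxf haφ := by
    subst hxf haφ
    refine ObjectProperty.hom_ext _ (Endofunctor.Algebra.ext ((S.lift_comp _ φ).trans ?_))
    exact congrArg (S.lift A'.1)
      (S.extend_comp (isHomLift_forget_iff.1 ha) _ (isHomLift_forget_iff.1 hφ)).symm
  transport_const x A a ha :=
    ObjectProperty.hom_ext _ <| Endofunctor.Algebra.ext <|
      (congrArg (S.lift A.1) (S.extend_const _)).trans (S.lift_const a.hom.f)

theorem not_isElementary (A : PointedAlgebra η) {φ ψ : S.J ⟶ A.obj.a} (hp : p.map φ = p.map ψ)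
    (h : S.lift A φ = S.lift A ψ) (hne : S.target ≫ φ ≠ S.target ≫ ψ) :
    ¬ IsElementary (forget η ⋙ p) := by
  intro hE
  have hφ : p.IsHomLift (p.map φ) φ := .map φ
  have hψ : p.IsHomLift (p.map φ) ψ := hp ▸ .map ψ
  have hφ' : p.IsHomLift (p.map S.target ≫ p.map φ) (S.target ≫ φ) := inferInstance
  have hψ' : p.IsHomLift (p.map S.target ≫ p.map φ) (S.target ≫ ψ) := inferInstance
  have point_eq : S.ofPoint (S.target ≫ φ) = S.ofPoint (S.target ≫ ψ) := by
    refine S.pathTransport.transport_injective_of_isElementary hE (A := ⟨A, rfl⟩) (x := p.map φ)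
      (isHomLift_forget_iff.2 hφ') (isHomLift_forget_iff.2 hψ') (congrArg S.ofPoint ?_)
    exact (congrArg (S.lift A) (S.extend_eq hφ' hφ rfl)).trans
      (h.trans (congrArg (S.lift A) (S.extend_eq hψ' hψ rfl).symm))
  exact hne (congrArg (fun m => m.hom.f) point_eq)

end PathLifting

end PointedAlgebra

/-- The groupoid on `T` with exactly one arrow between any two objects. Unlike in Mathlib's
`Codiscrete T`, the arrows live in `Type u`, as needed for an object of `Cat.{u, u}`. -/
structure Indiscrete (T : Type u) : Type u where
  as : T

namespace Indiscrete

variable {T : Type u}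

instance : Groupoid.{u} (Indiscrete T) where
  Hom _ _ := PUnit
  id _ := ⟨⟩
  comp _ _ := ⟨⟩
  inv _ := ⟨⟩

instance (x y : Indiscrete T) : Subsingleton (x ⟶ y) := inferInstanceAs (Subsingleton PUnit)

/-- A function on objects, as a functor to an indiscrete groupoid. -/
def functor {X : Type*} [Category* X] (f : X → T) : X ⥤ Indiscrete T where
  obj x := ⟨f x⟩
  map _ := ⟨⟩

theorem functor_ext {X : Type*} [Category* X] {F G : X ⥤ Indiscrete T}
    (h : ∀ x, F.obj x = G.obj x) : F = G :=
  CategoryTheory.Functor.ext h fun _ _ _ => Subsingleton.elim _ _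

/-- The isomorphism between two objects. -/
def iso (x y : Indiscrete T) : x ≅ y := ⟨⟨⟩, ⟨⟩, rfl, rfl⟩

/-- The functor given by an object. -/
def point {X : Type*} [Category* X] (x : X) : Indiscrete PUnit.{u + 1} ⥤ X where
  obj _ := x
  map _ := 𝟙 x

theorem point_ext {X : Type*} [Category* X] {F G : Indiscrete PUnit.{u + 1} ⥤ X}
    (h : F.obj ⟨⟨⟩⟩ = G.obj ⟨⟨⟩⟩) : F = G :=
  CategoryTheory.Functor.ext (fun _ => h) <| by
    rintro ⟨⟨⟩⟩ ⟨⟨⟩⟩ f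
    obtain rfl : f = 𝟙 _ := Subsingleton.elim _ _
    simp

/-- The groupoid with two isomorphic objects. -/
abbrev Interval := Indiscrete (ULift.{u} Bool)

/-- An endpoint of the interval. -/
abbrev endpoint (i : Bool) : Interval.{u} := ⟨⟨i⟩⟩

end Indiscrete

namespace IsoFact

open Indiscrete

/-- The object of `M (point (endpoint true))` given by the path from `endpoint false` to
`endpoint true` and the point over its target. -/
def intervalPath : M (point (endpoint.{u} true)) :=
  ⟨⟨⟨⟩⟩, endpoint false, iso _ _⟩

theorem R_comp_L_id : R (𝟭 (Indiscrete PUnit.{u + 1})) ⋙ L (𝟭 _) = 𝟭 _ :=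
  functor_hext (fun m => congrArg Indiscrete.mk (Subsingleton.elim m.b.as m.a.as)) (fun _ => rfl)
    (fun _ => HEq.rfl) (fun _ => HEq.rfl) (fun _ => HEq.rfl)

/-- The cleavage of the functor of indiscrete groupoids induced by `f`, given by a section `g`
of `f`, and normal: an identity is lifted to an identity. -/
def indiscreteStr {T T' : Type u} [DecidableEq T'] (f : T → T') (g : T' → T) :
    M (functor (f ∘ Indiscrete.as) : Indiscrete T ⥤ Indiscrete T') ⥤ Indiscrete T :=
  functor fun m => if m.b.as = f m.a.as then m.a.as else g m.b.as

section

variable {T T' : Type u} [DecidableEq T'] (f : T → T') (g : T' → T)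

theorem indiscreteStr_comp (hfg : ∀ t, f (g t) = t) :
    indiscreteStr f g ⋙ functor (f ∘ Indiscrete.as) = R (functor (f ∘ Indiscrete.as)) := by
  refine functor_ext fun m => ?_
  change (⟨f (if _ then _ else _)⟩ : Indiscrete T') = ⟨m.b.as⟩
  split_ifs with h
  · rw [h]
  · rw [hfg]

theorem L_comp_indiscreteStr :
    L (functor (f ∘ Indiscrete.as)) ⋙ indiscreteStr f g = 𝟭 (Indiscrete T) :=
  functor_ext fun _ => congrArg Indiscrete.mk (if_pos rfl)

end

/-- The map from three to two points with two points over `true`. -/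
def fold (t : Option (ULift.{u} Bool)) : ULift.{u} Bool := t.getD ⟨true⟩

end IsoFact

open IsoFact Indiscrete PointedAlgebra

namespace CatR

instance isIso_unit_right (F : Arrow Cat.{u, u}) : IsIso (unit.app F).right :=
  inferInstanceAs (IsIso (𝟙 F.right))

instance (F : Arrow Cat.{u, u}) : IsIso (Arrow.rightFunc.map (unit.app F)) :=
  isIso_unit_right F

/-- An arrow from `J`, the inclusion of the endpoint `true` in the interval, to `F` is an
isomorphism in the codomain of `F` with a point of the domain over its target. -/
def pathLifting : PathLifting unit.{u} Arrow.rightFunc where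
  pt := Arrow.mk (𝟙 (Cat.of (Indiscrete PUnit)))
  J := Arrow.mk (point (endpoint true)).toCatHom
  isIso_unit := ⟨Arrow.homMk (IsoFact.R (𝟭 _)).toCatHom (𝟙 _) rfl,
    Arrow.hom_ext _ _ rfl rfl, Arrow.hom_ext _ _ (Cat.Hom.ext R_comp_L_id) rfl⟩
  target := Arrow.homMk (𝟙 _) (point (endpoint true)).toCatHom rfl
  const := Arrow.homMk (𝟙 _) (functor fun _ => PUnit.unit).toCatHom rfl
  start := Arrow.homMk (point intervalPath).toCatHom (point (endpoint false)).toCatHom rfl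
  target_const := rfl
  start_const := rfl
  isStronglyCocartesian :=
    FibProd.isStronglyCocartesian_rightFunc _ (IsIso.id _)

/-- The functor of indiscrete categories induced by `fold`, with the cleavage that lifts a
non-identity isomorphism to one whose source is in the image of `some`. -/
def foldAlgebra : PointedAlgebra unit.{u} where
  obj.a := Arrow.mk (X := Cat.of (Indiscrete (Option (ULift.{u} Bool)))) (Y := Cat.of Interval)
    (functor (fold ∘ Indiscrete.as)).toCatHom
  obj.str := Arrow.homMk (indiscreteStr fold some).toCatHom (𝟙 _)
    (congrArg Functor.toCatHom (indiscreteStr_comp fold some fun _ => rfl))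
  property := Arrow.hom_ext _ _
    (congrArg Functor.toCatHom (L_comp_indiscreteStr fold some)) rfl

/-- The nontrivial path of the interval, with the point `t` over its target. -/
def foldPath (t : Option (ULift.{u} Bool)) (ht : fold t = ⟨true⟩) :
    pathLifting.{u}.J ⟶ foldAlgebra.obj.a :=
  Arrow.homMk (point (X := Indiscrete _) ⟨t⟩).toCatHom (𝟙 _)
    (Cat.Hom.ext (point_ext (congrArg Indiscrete.mk ht)))

theorem not_isElementary : ¬ FibProd.IsElementary (pointedAlgebraCod unit.{u}) := by
  refine pathLifting.{u}.not_isElementary foldAlgebra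
    (φ := foldPath none rfl) (ψ := foldPath (some ⟨true⟩) rfl) rfl ?_ fun h => ?_
  · exact Arrow.hom_ext _ _ (Cat.Hom.ext (point_ext rfl)) rfl
  · have h' := congrArg (fun f => (f.left.toFunctor.obj ⟨⟨⟩⟩).as) h
    exact Option.some_ne_none _ h'.symm

end CatR

namespace GrpdR

instance isIso_unit_right (F : Arrow Grpd.{u, u}) : IsIso (unit.app F).right :=
  inferInstanceAs (IsIso (𝟙 F.right))

instance (F : Arrow Grpd.{u, u}) : IsIso (Arrow.rightFunc.map (unit.app F)) :=
  isIso_unit_right F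

instance : HasLimits Grpd.{u, u} :=
  hasLimits_of_reflective Grpd.forgetToCat

/-- An arrow from `J`, the inclusion of the endpoint `true` in the interval, to `F` is an
isomorphism in the codomain of `F` with a point of the domain over its target. -/
def pathLifting : PathLifting unit.{u} Arrow.rightFunc where
  pt := Arrow.mk (𝟙 (Grpd.of (Indiscrete PUnit)))
  J := Arrow.mk (X := Grpd.of (Indiscrete PUnit)) (Y := Grpd.of Interval) (point (endpoint true))
  isIso_unit := ⟨Arrow.homMk (IsoFact.R (𝟭 _)) (𝟙 _) rfl,
    Arrow.hom_ext _ _ rfl rfl, Arrow.hom_ext _ _ R_comp_L_id rfl⟩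
  target := Arrow.homMk (𝟙 _) (point (endpoint true)) rfl
  const := Arrow.homMk (𝟙 _) (functor fun _ => PUnit.unit) rfl
  start := Arrow.homMk (point intervalPath) (point (endpoint false)) rfl
  target_const := rfl
  start_const := rfl
  isStronglyCocartesian :=
    FibProd.isStronglyCocartesian_rightFunc _ (IsIso.id _)

/-- The functor of indiscrete categories induced by `fold`, with the cleavage that lifts a
non-identity isomorphism to one whose source is in the image of `some`. -/
def foldAlgebra : PointedAlgebra unit.{u} where
  obj.a := Arrow.mk (X := Grpd.of (Indiscrete (Option (ULift.{u} Bool)))) (Y := Grpd.of Interval)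
    (functor (fold ∘ Indiscrete.as))
  obj.str := Arrow.homMk (indiscreteStr fold some) (𝟙 _) (indiscreteStr_comp fold some fun _ => rfl)
  property := Arrow.hom_ext _ _ (L_comp_indiscreteStr fold some) rfl

/-- The nontrivial path of the interval, with the point `t` over its target. -/
def foldPath (t : Option (ULift.{u} Bool)) (ht : fold t = ⟨true⟩) :
    pathLifting.{u}.J ⟶ foldAlgebra.obj.a :=
  Arrow.homMk (point (X := Indiscrete _) ⟨t⟩) (𝟙 _) (point_ext (congrArg Indiscrete.mk ht))

theorem not_isElementary : ¬ FibProd.IsElementary (pointedAlgebraCod unit.{u}) := by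
  refine pathLifting.{u}.not_isElementary foldAlgebra
    (φ := foldPath none rfl) (ψ := foldPath (some ⟨true⟩) rfl) rfl ?_ fun h => ?_
  · exact Arrow.hom_ext _ _ (point_ext rfl) rfl
  · have h' := congrArg (fun f => (f.left.obj ⟨⟨⟩⟩).as) h
    exact Option.some_ne_none _ h'.symm

end GrpdR

theorem corollary5p7 :
    (FibProd.IsFibrationWithProducts (pointedAlgebraCod CatR.unit.{u}) ∧
      ¬ FibProd.IsElementary (pointedAlgebraCod CatR.unit.{u})) ∧
    (FibProd.IsFibrationWithProducts (pointedAlgebraCod GrpdR.unit.{u}) ∧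
      ¬ FibProd.IsElementary (pointedAlgebraCod GrpdR.unit.{u})) :=
  ⟨⟨isFibrationWithProducts _, CatR.not_isElementary⟩,
    ⟨isFibrationWithProducts _, GrpdR.not_isElementary⟩⟩
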